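/- There is a universal constant $c>0$ such that the following holds. Let $d>4$ be an integer, $0\le\eta<\frac12$, $0<\epsilon\le\frac1{4\pi}$ and $0<\delta\le\frac14$, and let $X$ be uniformly distributed on the unit sphere $\mathbb{S}^{d-1}\subset\mathbb{R}^d$. Put $\operatorname{sign}(t)=+1$ for $t\ge 0$ and $\operatorname{sign}(t)=-1$ for $t<0$. An active learning algorithm $\mathcal{A}$ is a (possibly randomized) procedure that may draw i.i.d. unlabeled examples distributed as $X$, may adaptively query points $x\in\mathbb{S}^{d-1}$ to a labeling oracle, each such query being answered by an independent draw from the oracle's conditional distribution of a label $Y\in\{+1,-1\}$ given $X=x$, and may stop and output a vector $v\in\mathbb{S}^{d-1}$. A labeling oracle $\mathcal{O}$ satisfies the $\eta$-bounded noise condition with respect to $u\in\mathbb{S}^{d-1}$ if $\mathbb{P}[Y\ne\operatorname{sign}(u\cdot x)\mid X=x]\le\eta$ for every $x\in\mathbb{S}^{d-1}$. For every active learning algorithm $\mathcal{A}$ there are a $u\in\mathbb{S}^{d-1}$ and a labeling oracle $\mathcal{O}$ satisfying the $\eta$-bounded noise condition with respect to $u$ such that, for every $n\in\mathbb{N}$: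 if with probability at least $1-\delta$ the algorithm $\mathcal{A}$, run with $\mathcal{O}$, makes at most $n$ label queries and outputs $v\in\mathbb{S}^{d-1}$ with $\mathbb{P}[\operatorname{sign}(v\cdot X)\ne\operatorname{sign}(u\cdot X)]\le\epsilon$, then $$n\ \ge\ c\left(\frac{d\,\ln\frac1\epsilon}{(1-2\eta)^2}+\frac{\eta\,\ln\frac1\delta}{(1-2\eta)^2}\right).$$ -/

import Mathlib

open MeasureTheory
open scoped ENNReal

universe u

noncomputable section

namespace HalfspaceLearning

/-- The instance space: the unit sphere of `ℝ^d`. -/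
abbrev UnitSphere (d : ℕ) : Type :=
  Metric.sphere (0 : EuclideanSpace ℝ (Fin d)) 1

/-- The uniform distribution on the unit sphere: normalized surface measure. -/
def uniformSphere (d : ℕ) : Measure (UnitSphere d) :=
  ((volume : Measure (EuclideanSpace ℝ (Fin d))).toSphere Set.univ)⁻¹ •
    (volume : Measure (EuclideanSpace ℝ (Fin d))).toSphere

theorem isProbabilityMeasure_uniformSphere (d : ℕ) (hd : d ≠ 0) :
    IsProbabilityMeasure (uniformSphere d) := by
  have : NeZero d := ⟨hd⟩
  have : Nonempty (Fin d) := ⟨⟨0, Nat.pos_of_ne_zero hd⟩⟩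
  constructor
  have h0 : (volume : Measure (EuclideanSpace ℝ (Fin d))).toSphere Set.univ ≠ 0 :=
    fun h => Measure.toSphere_ne_zero _ (Measure.measure_univ_eq_zero.mp h)
  simp only [uniformSphere, Measure.smul_apply, smul_eq_mul]
  exact ENNReal.inv_mul_cancel h0 (measure_ne_top _ _)

/-- The homogeneous halfspace `h_w(x) = sign (w · x)`.  Labels are Booleans, `true` standing for
`+1` and `false` for `-1`; the sign of `0` is `+1`. -/
def halfspace {d : ℕ} (w x : UnitSphere d) : Bool :=
  decide (0 ≤ inner ℝ (w : EuclideanSpace ℝ (Fin d)) (x : EuclideanSpace ℝ (Fin d)))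

/-- `P[sign (v · X) ≠ sign (w · X)]` for `X` uniform on the unit sphere. -/
def disagreement {d : ℕ} (v w : UnitSphere d) : ℝ :=
  (uniformSphere d).real {x | halfspace v x ≠ halfspace w x}

/-- A labeling oracle: the conditional distribution of the label `Y` given the instance `X = x`,
depending measurably on `x`. -/
structure LabelingOracle (d : ℕ) where
  label : UnitSphere d → PMF Bool
  measurable_label : ∀ y, Measurable fun x => label x y

/-- The `η`-bounded noise condition with respect to `w`:
`P[Y ≠ sign (w · x) | X = x] ≤ η` for every `x`. -/
def LabelingOracle.BoundedNoise {d : ℕ} (O : LabelingOracle d) (η : ℝ) (w : UnitSphere d) :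
    Prop :=
  ∀ x, (O.label x).toOuterMeasure {y | y ≠ halfspace w x} ≤ ENNReal.ofReal η

/-- An active learning algorithm on the unit sphere of `ℝ^d`.  It may toss coins (a random element
of an arbitrary probability space `Coin`), draw unlabeled examples, and adaptively query labels.
The unlabeled examples are presented as an infinite sequence which the algorithm may inspect at
will.  `next ω s h` is the next step of the algorithm when its coins are `ω`, the unlabeled
examples are `s` and the list of queried points with the labels received so far, in
chronological order, is `h`: either `Sum.inl x`, query the label of the point `x`, or
`Sum.inr v`, stop and output the halfspace with normal vector `v`.  An algorithm need not stop;
a run that goes on forever is one that keeps querying. -/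
structure ActiveLearner (d : ℕ) where
  Coin : Type u
  measurableSpaceCoin : MeasurableSpace Coin
  coinLaw : Measure Coin
  isProbabilityMeasure_coinLaw : IsProbabilityMeasure coinLaw
  next : Coin → (ℕ → UnitSphere d) → List (UnitSphere d × Bool) → UnitSphere d ⊕ UnitSphere d
  measurable_next : ∀ k : ℕ,
    Measurable fun p : Coin × (ℕ → UnitSphere d) × (Fin k → UnitSphere d × Bool) =>
      next p.1 p.2.1 (List.ofFn p.2.2)

attribute [instance] ActiveLearner.measurableSpaceCoin ActiveLearner.isProbabilityMeasure_coinLaw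

namespace ActiveLearner

variable {d : ℕ}

/-- Continue the interaction of the algorithm with the oracle from the history `h`, for fixed
coins `ω` and unlabeled examples `s`.  Each queried label is drawn afresh from the oracle.  The
result is `some v` if the algorithm stops with output `v` after at most `n` further queries, and
`none` if it asks for more than `n` further labels. -/
def run (A : ActiveLearner.{u} d) (O : LabelingOracle d) (ω : A.Coin) (s : ℕ → UnitSphere d) :
    ℕ → List (UnitSphere d × Bool) → PMF (Option (UnitSphere d))
  | 0, h =>
    match A.next ω s h with
    | Sum.inr v => PMF.pure (some v)
    | Sum.inl _ => PMF.pure none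
  | n + 1, h =>
    match A.next ω s h with
    | Sum.inr v => PMF.pure (some v)
    | Sum.inl x => (O.label x).bind fun y => A.run O ω s n (h ++ [(x, y)])

/-- The probability (over the coins, the unlabeled examples drawn i.i.d. from the uniform
distribution, and the answers of the oracle `O`) that the algorithm makes at most `n` label
queries and outputs a `v` with `P[sign (v · X) ≠ sign (w · X)] ≤ ε`. -/
def successProb (A : ActiveLearner.{u} d) (O : LabelingOracle d) (w : UnitSphere d) (ε : ℝ)
    (n : ℕ) : ℝ≥0∞ :=
  ∫⁻ p : A.Coin × (ℕ → UnitSphere d),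
    (A.run O p.1 p.2 n []).toOuterMeasure {r | ∃ v, r = some v ∧ disagreement v w ≤ ε}
    ∂(A.coinLaw.prod (Measure.infinitePi fun _ : ℕ => uniformSphere d))

end ActiveLearner

end HalfspaceLearning

end

/-! Every oracle used is random classification noise. If the claim failed for a learner, every
target would be learned with fewer than T queries, T being the claimed bound with c = 1/100. Success
only grows with the budget (`successProb_mono`), so one budget below T serves all targets. Two
changes of oracle refute this.

Dimension term: replace the labels by fair coins. The output then carries no information about the
target, so some target is found with probability at most the bound for an ε-ball of halfspaces,
which is at most 2(8ε)^(d-1) (`exists_eventProb_successSet_le`, `uniformSphere_disagreement_le`). A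
query contributes at most (1-2η)² of divergence, and raising this probability to 3/4 costs order d
log(1/ε), as in Fano's inequality (`dimension_bound`).

Confidence term: compare the targets `w` and `-w`. No output is good for both, and a query
contributes at most 2(1-2η)²/η (`confidence_bound`).

The accounting is `run_variational`: the Donsker-Varadhan inequality weakened by log x ≤ x - 1. In
that form it is affine in the two event probabilities, hence survives averaging over coins and
unlabeled examples. -/

noncomputable section

namespace HalfspaceLearning

variable {d : ℕ}

/-! ### Disagreement as a rotation-invariant pseudometric on the sphere. -/

section Geometry

open Set Module
open scoped Pointwise

theorem measurable_halfspace :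
    Measurable fun p : UnitSphere d × UnitSphere d => halfspace p.1 p.2 := by
  have hc : Continuous fun p : UnitSphere d × UnitSphere d =>
      (inner ℝ (p.1 : EuclideanSpace ℝ (Fin d)) (p.2 : EuclideanSpace ℝ (Fin d)) : ℝ) := by
    fun_prop
  have hm : MeasurableSet {p : UnitSphere d × UnitSphere d |
      (0 : ℝ) ≤ inner ℝ (p.1 : EuclideanSpace ℝ (Fin d)) (p.2 : EuclideanSpace ℝ (Fin d))} :=
    measurableSet_le measurable_const hc.measurable
  have : (fun p : UnitSphere d × UnitSphere d => halfspace p.1 p.2) = fun p =>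
      if p ∈ {p : UnitSphere d × UnitSphere d |
        (0 : ℝ) ≤ inner ℝ (p.1 : EuclideanSpace ℝ (Fin d)) (p.2 : EuclideanSpace ℝ (Fin d))}
      then true else false := by
    funext p
    by_cases h : (0 : ℝ) ≤ inner ℝ (p.1 : EuclideanSpace ℝ (Fin d))
      (p.2 : EuclideanSpace ℝ (Fin d)) <;> simp [halfspace, h]
  rw [this]
  exact Measurable.ite hm measurable_const measurable_const

theorem measurable_halfspace_right (v : UnitSphere d) : Measurable (halfspace v) :=
  measurable_halfspace.comp measurable_prodMk_left

theorem measurableSet_halfspace_ne (v w : UnitSphere d) :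
    MeasurableSet {x | halfspace v x ≠ halfspace w x} :=
  (measurableSet_eq_fun (measurable_halfspace_right v) (measurable_halfspace_right w)).compl

theorem measurable_disagreement [NeZero d] :
    Measurable fun p : UnitSphere d × UnitSphere d => disagreement p.1 p.2 := by
  have := isProbabilityMeasure_uniformSphere d (NeZero.ne d)
  have h1 : Measurable fun q : (UnitSphere d × UnitSphere d) × UnitSphere d =>
      halfspace q.1.1 q.2 :=
    measurable_halfspace.comp (g := fun p : UnitSphere d × UnitSphere d => halfspace p.1 p.2)
      (f := fun q : (UnitSphere d × UnitSphere d) × UnitSphere d => (q.1.1, q.2)) (by fun_prop)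
  have h2 : Measurable fun q : (UnitSphere d × UnitSphere d) × UnitSphere d =>
      halfspace q.1.2 q.2 :=
    measurable_halfspace.comp (g := fun p : UnitSphere d × UnitSphere d => halfspace p.1 p.2)
      (f := fun q : (UnitSphere d × UnitSphere d) × UnitSphere d => (q.1.2, q.2)) (by fun_prop)
  have hS : MeasurableSet {q : (UnitSphere d × UnitSphere d) × UnitSphere d |
      halfspace q.1.1 q.2 ≠ halfspace q.1.2 q.2} := (measurableSet_eq_fun h1 h2).compl
  exact (measurable_measure_prodMk_left (ν := uniformSphere d) hS).ennreal_toReal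

/-- Turns spherical measure into the relative volume of a truncated cone in the unit ball, so that
invariance, null sets and caps can be handled with Lebesgue measure. -/
theorem uniformSphere_apply [NeZero d] {s : Set (UnitSphere d)} (hs : MeasurableSet s) :
    uniformSphere d s = (volume (Metric.ball (0 : EuclideanSpace ℝ (Fin d)) 1))⁻¹ *
      volume (Ioo (0 : ℝ) 1 • ((↑) '' s : Set (EuclideanSpace ℝ (Fin d)))) := by
  have hd : (d : ℝ≥0∞) ≠ 0 := by simpa using NeZero.ne d
  rw [uniformSphere, Measure.smul_apply, smul_eq_mul, Measure.toSphere_apply_univ,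
    Measure.toSphere_apply' _ hs, finrank_euclideanSpace_fin,
    ENNReal.mul_inv (Or.inl hd) (Or.inl (ENNReal.natCast_ne_top d)),
    mul_comm (d : ℝ≥0∞)⁻¹, mul_assoc, ← mul_assoc _ (d : ℝ≥0∞),
    ENNReal.inv_mul_cancel hd (ENNReal.natCast_ne_top d), one_mul]

/-- The action of a linear isometry on the unit sphere. -/
def sphereMap (R : EuclideanSpace ℝ (Fin d) ≃ₗᵢ[ℝ] EuclideanSpace ℝ (Fin d))
    (v : UnitSphere d) : UnitSphere d :=
  ⟨R v, by simp⟩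

theorem halfspace_sphereMap (R : EuclideanSpace ℝ (Fin d) ≃ₗᵢ[ℝ] EuclideanSpace ℝ (Fin d))
    (v x : UnitSphere d) : halfspace (sphereMap R v) (sphereMap R x) = halfspace v x := by
  simp [halfspace, sphereMap]

theorem disagreement_sphereMap [NeZero d]
    (R : EuclideanSpace ℝ (Fin d) ≃ₗᵢ[ℝ] EuclideanSpace ℝ (Fin d)) (v w : UnitSphere d) :
    disagreement (sphereMap R v) (sphereMap R w) = disagreement v w := by
  have himage : ((↑) '' {x | halfspace (sphereMap R v) x ≠ halfspace (sphereMap R w) x} :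
      Set (EuclideanSpace ℝ (Fin d))) = R '' ((↑) '' {x | halfspace v x ≠ halfspace w x}) := by
    ext y
    constructor
    · rintro ⟨x, hx, rfl⟩
      have hRx : sphereMap R (sphereMap R.symm x) = x := by
        ext1; simp [sphereMap]
      refine ⟨_, ⟨sphereMap R.symm x, ?_, rfl⟩, congrArg Subtype.val hRx⟩
      rw [mem_ofPred_eq, ← hRx, halfspace_sphereMap, halfspace_sphereMap] at hx
      exact hx
    · rintro ⟨_, ⟨x, hx, rfl⟩, rfl⟩
      refine ⟨sphereMap R x, ?_, rfl⟩
      rwa [mem_ofPred_eq, halfspace_sphereMap, halfspace_sphereMap]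
  have hsmul (T : Set (EuclideanSpace ℝ (Fin d))) :
      Ioo (0 : ℝ) 1 • (R '' T) = R '' (Ioo (0 : ℝ) 1 • T) := by
    ext y
    simp only [mem_smul, mem_image]
    constructor
    · rintro ⟨t, ht, _, ⟨x, hx, rfl⟩, rfl⟩
      exact ⟨t • x, ⟨t, ht, x, hx, rfl⟩, by simp⟩
    · rintro ⟨_, ⟨t, ht, x, hx, rfl⟩, rfl⟩
      exact ⟨t, ht, R x, ⟨x, hx, rfl⟩, by simp⟩
  have hvol (T : Set (EuclideanSpace ℝ (Fin d))) : volume (R '' T) = volume T := by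
    rw [R.image_eq_preimage_symm]
    exact R.symm.measurePreserving.measure_preimage_emb
      R.symm.toHomeomorph.measurableEmbedding T
  rw [disagreement, disagreement, measureReal_def, measureReal_def,
    uniformSphere_apply (measurableSet_halfspace_ne _ _),
    uniformSphere_apply (measurableSet_halfspace_ne _ _), himage, hsmul, hvol]

theorem disagreement_comm (v w : UnitSphere d) : disagreement v w = disagreement w v := by
  simp only [disagreement, ne_comm]

theorem disagreement_triangle [NeZero d] (u v w : UnitSphere d) :
    disagreement u w ≤ disagreement u v + disagreement v w := by
  have := isProbabilityMeasure_uniformSphere d (NeZero.ne d)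
  refine (measureReal_mono ?_).trans (measureReal_union_le _ _)
  intro x hx
  by_contra h
  simp only [mem_union, mem_ofPred_eq, not_or, not_not] at h
  exact hx (h.1.trans h.2)

theorem disagreement_self (v : UnitSphere d) : disagreement v v = 0 := by
  simp [disagreement]

theorem uniformSphere_orthogonal [NeZero d] (v : UnitSphere d) :
    uniformSphere d {x | (inner ℝ (v : EuclideanSpace ℝ (Fin d))
      (x : EuclideanSpace ℝ (Fin d)) : ℝ) = 0} = 0 := by
  have hc : Continuous fun x : UnitSphere d =>
      (inner ℝ (v : EuclideanSpace ℝ (Fin d)) (x : EuclideanSpace ℝ (Fin d)) : ℝ) := by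
    fun_prop
  rw [uniformSphere_apply (measurableSet_eq_fun hc.measurable measurable_const)]
  refine mul_eq_zero_of_right _ (measure_mono_null ?_
    (Measure.addHaar_submodule volume (ℝ ∙ (v : EuclideanSpace ℝ (Fin d)))ᗮ ?_))
  · rintro _ ⟨t, -, _, ⟨x, hx, rfl⟩, rfl⟩
    exact Submodule.smul_mem _ _ ((Submodule.mem_orthogonal_singleton_iff_inner_right).mpr hx)
  · intro h
    have hv : (v : EuclideanSpace ℝ (Fin d)) ∈ (ℝ ∙ (v : EuclideanSpace ℝ (Fin d)))ᗮ := by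
      rw [h]; trivial
    rw [Submodule.mem_orthogonal_singleton_iff_inner_right, real_inner_self_eq_norm_sq] at hv
    simp at hv

/-- Opposite halfspaces agree only on the hyperplane orthogonal to `v`, which is null. -/
theorem disagreement_neg [NeZero d] (v : UnitSphere d) : disagreement v (-v) = 1 := by
  have := isProbabilityMeasure_uniformSphere d (NeZero.ne d)
  have h0 : (uniformSphere d).real {x | halfspace v x ≠ halfspace (-v) x}ᶜ = 0 := by
    rw [measureReal_def, measure_mono_null ?_ (uniformSphere_orthogonal v)]
    · simp
    · intro x hx
      simp only [mem_compl_iff, mem_ofPred_eq, not_not, halfspace, decide_eq_decide,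
        Metric.sphere, coe_neg_sphere, inner_neg_left] at hx ⊢
      rcases le_total 0 (inner ℝ (v : EuclideanSpace ℝ (Fin d))
        (x : EuclideanSpace ℝ (Fin d)) : ℝ) with h | h
      · have := hx.mp h; linarith
      · have := hx.mpr (by linarith); linarith
  rw [probReal_compl_eq_one_sub (measurableSet_halfspace_ne _ _)] at h0
  rw [disagreement]; linarith

/-- Where `v` and `w` give the same sign, so does a nonnegative combination of them. Since sign 0 =
+1, the negative case needs strictness, which comes from a + b > 0. -/
theorem disagreement_le_of_combination [NeZero d] {u v w : UnitSphere d} {a b : ℝ} (ha : 0 ≤ a)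
    (hb : 0 ≤ b) (h : (u : EuclideanSpace ℝ (Fin d)) = a • (v : EuclideanSpace ℝ (Fin d)) +
      b • (w : EuclideanSpace ℝ (Fin d))) : disagreement v u ≤ disagreement v w := by
  have := isProbabilityMeasure_uniformSphere d (NeZero.ne d)
  refine measureReal_mono ?_
  intro x hx hvw
  apply hx
  have hab : 0 < a + b := by
    rcases (add_nonneg ha hb).lt_or_eq with h' | h'
    · exact h'
    · have hu : ‖(u : EuclideanSpace ℝ (Fin d))‖ = 1 := by simp
      rw [h, show a = 0 by linarith, show b = 0 by linarith] at hu
      simp at hu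
  simp only [halfspace, decide_eq_decide, h, inner_add_left, real_inner_smul_left] at hvw ⊢
  rcases le_or_gt 0 (inner ℝ (v : EuclideanSpace ℝ (Fin d))
    (x : EuclideanSpace ℝ (Fin d)) : ℝ) with hv | hv
  · have hw := hvw.mp hv
    exact ⟨fun _ => by positivity, fun _ => hv⟩
  · have hw := not_le.mp (mt hvw.mpr (not_le.mpr hv))
    refine ⟨fun h' => absurd h' (not_le.mpr hv), fun h' => ?_⟩
    rcases ha.lt_or_eq with ha' | rfl
    · nlinarith [mul_pos ha' (neg_pos.mpr hv), mul_nonneg hb (neg_pos.mpr hw).le]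
    · nlinarith [mul_pos (by linarith : 0 < b) (neg_pos.mpr hw)]

/-! ### Disagreement against angle along great circles. -/

/-- The point at angle `t` of the great circle through the orthogonal unit vectors `v` and `e`. -/
def circlePoint (v e : UnitSphere d) (h : (inner ℝ (v : EuclideanSpace ℝ (Fin d))
    (e : EuclideanSpace ℝ (Fin d)) : ℝ) = 0) (t : ℝ) : UnitSphere d :=
  ⟨Real.cos t • (v : EuclideanSpace ℝ (Fin d)) + Real.sin t • (e : EuclideanSpace ℝ (Fin d)), by
    have h2 := norm_add_sq_real (Real.cos t • (v : EuclideanSpace ℝ (Fin d)))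
      (Real.sin t • (e : EuclideanSpace ℝ (Fin d)))
    rw [real_inner_smul_left, real_inner_smul_right, h, norm_smul, norm_smul] at h2
    simp only [norm_eq_of_mem_sphere, mul_zero, mul_one, add_zero, Real.norm_eq_abs, sq_abs,
      Real.cos_sq_add_sin_sq] at h2
    rw [mem_sphere_zero_iff_norm]
    exact (pow_eq_one_iff_of_nonneg (norm_nonneg _) two_ne_zero).mp h2⟩

section circlePoint

variable (v e : UnitSphere d) (h : (inner ℝ (v : EuclideanSpace ℝ (Fin d))
    (e : EuclideanSpace ℝ (Fin d)) : ℝ) = 0)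

theorem coe_circlePoint (t : ℝ) : (circlePoint v e h t : EuclideanSpace ℝ (Fin d)) =
    Real.cos t • (v : EuclideanSpace ℝ (Fin d)) + Real.sin t • (e : EuclideanSpace ℝ (Fin d)) :=
  rfl

theorem circlePoint_zero : circlePoint v e h 0 = v := by
  ext1; simp [coe_circlePoint]

theorem circlePoint_pi : circlePoint v e h Real.pi = -v := by
  ext1; simp [coe_circlePoint]

theorem inner_circlePoint (s t : ℝ) : (inner ℝ (circlePoint v e h s : EuclideanSpace ℝ (Fin d))
    (circlePoint v e h t : EuclideanSpace ℝ (Fin d)) : ℝ) = Real.cos (s - t) := by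
  have h' := h
  rw [real_inner_comm] at h'
  simp only [coe_circlePoint, inner_add_left, inner_add_right, real_inner_smul_left,
    real_inner_smul_right, h, h', real_inner_self_eq_norm_sq, norm_eq_of_mem_sphere,
    Real.cos_sub]
  ring

theorem disagreement_circlePoint_add [NeZero d] (s t : ℝ) :
    disagreement (circlePoint v e h s) (circlePoint v e h (s + t)) =
      disagreement (circlePoint v e h s) (circlePoint v e h (s - t)) := by
  -- This reflection exchanges the points at angles s - t and s + t and fixes the one at s.
  set R := (ℝ ∙ ((circlePoint v e h (s - t) : EuclideanSpace ℝ (Fin d)) -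
    circlePoint v e h (s + t)))ᗮ.reflection
  have h1 : sphereMap R (circlePoint v e h (s - t)) = circlePoint v e h (s + t) := by
    ext1
    exact Submodule.reflection_sub (by simp)
  have h2 : sphereMap R (circlePoint v e h s) = circlePoint v e h s := by
    ext1
    refine Submodule.reflection_mem_subspace_eq_self
      (Submodule.mem_orthogonal_singleton_iff_inner_left.mpr ?_)
    rw [inner_sub_right, inner_circlePoint, inner_circlePoint, sub_sub_cancel,
      sub_add_cancel_left, Real.cos_neg, sub_self]
  rw [← disagreement_sphereMap R (circlePoint v e h s) (circlePoint v e h (s - t)), h1, h2]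

theorem disagreement_circlePoint_step [NeZero d] (t : ℝ) (j : ℕ) :
    disagreement (circlePoint v e h (j * t)) (circlePoint v e h ((j + 1 : ℕ) * t)) =
      disagreement v (circlePoint v e h t) := by
  induction j with
  | zero => simp [circlePoint_zero]
  | succ j ih =>
    rw [← ih, disagreement_comm (circlePoint v e h (j * t)),
      show ((j + 1 + 1 : ℕ) : ℝ) * t = (j + 1 : ℕ) * t + t by push_cast; ring,
      show (j : ℝ) * t = (j + 1 : ℕ) * t - t by push_cast; ring]
    exact disagreement_circlePoint_add v e h _ _

theorem disagreement_circlePoint_mul_le [NeZero d] (t : ℝ) (k : ℕ) :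
    disagreement v (circlePoint v e h (k * t)) ≤ k * disagreement v (circlePoint v e h t) := by
  induction k with
  | zero => simp [circlePoint_zero, disagreement_self]
  | succ k ih =>
    refine (disagreement_triangle v (circlePoint v e h (k * t)) _).trans ?_
    rw [disagreement_circlePoint_step]
    push_cast
    linarith

theorem disagreement_circlePoint_mono [NeZero d] {s t : ℝ} (hs : 0 ≤ s) (hst : s ≤ t)
    (ht : 0 < t) (htpi : t < Real.pi) :
    disagreement v (circlePoint v e h s) ≤ disagreement v (circlePoint v e h t) := by
  have hsin := Real.sin_pos_of_pos_of_lt_pi ht htpi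
  -- Spherical interpolation: the point at angle s as a combination of `v` and the point at angle t.
  refine disagreement_le_of_combination (a := Real.sin (t - s) / Real.sin t)
    (b := Real.sin s / Real.sin t)
    (div_nonneg (Real.sin_nonneg_of_nonneg_of_le_pi (by linarith) (by linarith)) hsin.le)
    (div_nonneg (Real.sin_nonneg_of_nonneg_of_le_pi hs (by linarith)) hsin.le) ?_
  simp only [coe_circlePoint, smul_add, smul_smul, Real.sin_sub, ← add_assoc, ← add_smul]
  congr 2 <;> field_simp
  ring

end circlePoint

theorem inner_eq_cos_angle (v w : UnitSphere d) :
    (inner ℝ (v : EuclideanSpace ℝ (Fin d)) (w : EuclideanSpace ℝ (Fin d)) : ℝ) =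
      Real.cos (InnerProductGeometry.angle (v : EuclideanSpace ℝ (Fin d)) w) := by
  simp [InnerProductGeometry.cos_angle]

theorem exists_circlePoint_eq {v w : UnitSphere d}
    (h0 : 0 < InnerProductGeometry.angle (v : EuclideanSpace ℝ (Fin d)) w)
    (hpi : InnerProductGeometry.angle (v : EuclideanSpace ℝ (Fin d)) w < Real.pi) :
    ∃ (e : UnitSphere d) (h : (inner ℝ (v : EuclideanSpace ℝ (Fin d))
      (e : EuclideanSpace ℝ (Fin d)) : ℝ) = 0),
      circlePoint v e h (InnerProductGeometry.angle (v : EuclideanSpace ℝ (Fin d)) w) = w := by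
  set θ := InnerProductGeometry.angle (v : EuclideanSpace ℝ (Fin d)) w with hθ
  have hsin := Real.sin_pos_of_pos_of_lt_pi h0 hpi
  have hin := inner_eq_cos_angle v w
  rw [← hθ] at hin
  set f := (w : EuclideanSpace ℝ (Fin d)) - Real.cos θ • (v : EuclideanSpace ℝ (Fin d)) with hf
  have hvf : (inner ℝ (v : EuclideanSpace ℝ (Fin d)) f : ℝ) = 0 := by
    rw [hf, inner_sub_right, real_inner_smul_right, hin, real_inner_self_eq_norm_sq]
    simp
  have hnorm : ‖f‖ = Real.sin θ := by
    have h2 := norm_sub_sq_real (w : EuclideanSpace ℝ (Fin d))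
      (Real.cos θ • (v : EuclideanSpace ℝ (Fin d)))
    rw [real_inner_smul_right, real_inner_comm, hin, norm_smul, ← hf] at h2
    simp only [norm_eq_of_mem_sphere, mul_one, Real.norm_eq_abs, sq_abs] at h2
    refine (sq_eq_sq₀ (norm_nonneg _) hsin.le).mp ?_
    rw [h2, Real.sin_sq]; ring
  refine ⟨⟨(Real.sin θ)⁻¹ • f, ?_⟩, ?_, ?_⟩
  · rw [mem_sphere_zero_iff_norm, norm_smul, hnorm, norm_inv, Real.norm_of_nonneg hsin.le,
      inv_mul_cancel₀ hsin.ne']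
  · simp [real_inner_smul_right, hvf]
  · ext1
    rw [coe_circlePoint, smul_smul, mul_inv_cancel₀ hsin.ne', one_smul, hf]
    abel

/-- Going from `v` to `-v` in k equal steps of angle π/k accumulates disagreement 1, so a single
step has at least 1/k; monotonicity along the circle covers larger angles. This replaces the exact
formula angle/π. -/
theorem inv_natCast_le_disagreement [NeZero d] {v w : UnitSphere d} {k : ℕ} (hk : 0 < k)
    (h : Real.pi / k ≤ InnerProductGeometry.angle (v : EuclideanSpace ℝ (Fin d)) w) :
    1 / (k : ℝ) ≤ disagreement v w := by
  have hk' : (0 : ℝ) < k := Nat.cast_pos.mpr hk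
  have h0 := (div_pos Real.pi_pos hk').trans_le h
  rcases (InnerProductGeometry.angle_le_pi (v : EuclideanSpace ℝ (Fin d)) w).lt_or_eq with hpi | hpi
  · obtain ⟨e, he, hw⟩ := exists_circlePoint_eq h0 hpi
    have h1 := disagreement_circlePoint_mul_le v e he (Real.pi / k) k
    rw [mul_div_cancel₀ _ hk'.ne', circlePoint_pi, disagreement_neg] at h1
    have h2 := disagreement_circlePoint_mono v e he (div_pos Real.pi_pos hk').le h h0 hpi
    rw [hw] at h2
    rw [div_le_iff₀ hk']
    nlinarith
  · have hin := inner_eq_cos_angle v w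
    rw [hpi, Real.cos_pi] at hin
    have hw : w = -v := by
      ext1
      rw [coe_neg_sphere, eq_neg_iff_add_eq_zero, ← norm_eq_zero, ← sq_eq_zero_iff,
        norm_add_sq_real, real_inner_comm, hin]
      simp only [norm_eq_of_mem_sphere]; norm_num
    rw [hw, disagreement_neg, div_le_one hk']
    exact Nat.one_le_cast.mpr hk

theorem norm_sub_le_angle (v w : UnitSphere d) :
    ‖(v : EuclideanSpace ℝ (Fin d)) - w‖ ≤
      InnerProductGeometry.angle (v : EuclideanSpace ℝ (Fin d)) w := by
  refine abs_le_of_sq_le_sq' ?_ (InnerProductGeometry.angle_nonneg _ _) |>.2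
  rw [norm_sub_sq_real, inner_eq_cos_angle]
  simp only [norm_eq_of_mem_sphere]
  linarith [Real.one_sub_sq_div_two_le_cos
    (x := InnerProductGeometry.angle (v : EuclideanSpace ℝ (Fin d)) w)]

theorem norm_sub_le_of_disagreement_le [NeZero d] {v w : UnitSphere d} {ε : ℝ} (hε : 0 < ε)
    (hε' : ε ≤ 1 / (4 * Real.pi)) (h : disagreement v w ≤ ε) :
    ‖(v : EuclideanSpace ℝ (Fin d)) - w‖ ≤ 4 * ε := by
  have hpi := Real.pi_gt_three
  have hpi4 := Real.pi_lt_d2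
  have hε1 : ε * (4 * Real.pi) ≤ 1 := by rwa [le_div_iff₀ (by positivity)] at hε'
  have hεs : ε ≤ 1 / 12 := by nlinarith
  refine (norm_sub_le_angle v w).trans ?_
  by_contra! hθ
  -- The largest integer strictly below 1/ε: then 1/k > ε, while εk ≥ 1 - ε ≥ 11/12 still gives π/k
  -- ≤ 4ε.
  obtain ⟨k, hk⟩ : ∃ k : ℕ, k = ⌈1 / ε⌉₊ - 1 := ⟨_, rfl⟩
  have hceil : 1 / ε ≤ ⌈1 / ε⌉₊ := Nat.le_ceil _
  have h12 : 12 ≤ 1 / ε := by rw [le_div_iff₀ hε]; linarith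
  have hc12 : (12 : ℝ) ≤ ⌈1 / ε⌉₊ := h12.trans hceil
  have hc12' : 12 ≤ ⌈1 / ε⌉₊ := by exact_mod_cast hc12
  have hk0 : 0 < k := by omega
  have hkr : (0 : ℝ) < k := Nat.cast_pos.mpr hk0
  have hk1 : (k : ℝ) + 1 = ⌈1 / ε⌉₊ := by
    have : k + 1 = ⌈1 / ε⌉₊ := by omega
    exact_mod_cast this
  have hklt : (k : ℝ) < 1 / ε := by
    have := Nat.ceil_lt_add_one (show 0 ≤ 1 / ε by positivity)
    linarith
  have hkge : 1 ≤ ε * (k + 1) := by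
    rw [hk1]
    calc (1 : ℝ) = ε * (1 / ε) := by field_simp
      _ ≤ _ := by gcongr
  have hlow := inv_natCast_le_disagreement (v := v) (w := w) hk0 (le_trans (by
    rw [div_le_iff₀ hkr]
    nlinarith) hθ.le)
  rw [lt_div_iff₀ hε] at hklt
  have : 1 / (k : ℝ) ≤ ε := hlow.trans h
  rw [div_le_iff₀ hkr] at this
  linarith

/-! ### Volume of spherical caps. -/

/-- A bound for the uniform measure of the spherical cap of chordal radius `r`. -/
theorem uniformSphere_cap_le [NeZero d] (v : UnitSphere d) {r : ℝ} (hr : 0 < r) :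
    uniformSphere d {w | ‖(v : EuclideanSpace ℝ (Fin d)) - w‖ ≤ r} ≤
      ENNReal.ofReal ((1 / (2 * r) + 1) * (2 * r) ^ d) := by
  have hmeas : MeasurableSet {w : UnitSphere d | ‖(v : EuclideanSpace ℝ (Fin d)) - w‖ ≤ r} :=
    (isClosed_le (by fun_prop) continuous_const).measurableSet
  -- The cone over the cap stays within r of its axis. Centres at odd multiples of r on the axis
  -- leave an axial error of at most r, so balls of radius 2r cover it.
  have hcover : Ioo (0 : ℝ) 1 • ((↑) '' {w : UnitSphere d |
      ‖(v : EuclideanSpace ℝ (Fin d)) - w‖ ≤ r} : Set (EuclideanSpace ℝ (Fin d))) ⊆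
      ⋃ j ∈ Finset.range ⌈1 / (2 * r)⌉₊,
        Metric.closedBall (((2 * j + 1) * r) • (v : EuclideanSpace ℝ (Fin d))) (2 * r) := by
    rintro _ ⟨t, ⟨ht0, ht1⟩, _, ⟨w, hw, rfl⟩, rfl⟩
    simp only [mem_iUnion, Finset.mem_range, exists_prop]
    have hpos : 0 ≤ t / (2 * r) := by positivity
    have hfl := Nat.floor_le hpos
    have hfl' := Nat.lt_floor_add_one (t / (2 * r))
    rw [le_div_iff₀ (by positivity)] at hfl
    rw [div_lt_iff₀ (by positivity)] at hfl'
    refine ⟨⌊t / (2 * r)⌋₊, ?_, ?_⟩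
    · rw [Nat.lt_ceil]
      refine (Nat.floor_le hpos).trans_lt ?_
      gcongr
    · rw [mem_closedBall_iff_norm]
      calc ‖t • (w : EuclideanSpace ℝ (Fin d)) -
            ((2 * (⌊t / (2 * r)⌋₊ : ℝ) + 1) * r) • (v : EuclideanSpace ℝ (Fin d))‖
          = ‖-(t • ((v : EuclideanSpace ℝ (Fin d)) - w)) +
            (t - (2 * (⌊t / (2 * r)⌋₊ : ℝ) + 1) * r) • (v : EuclideanSpace ℝ (Fin d))‖ := by
              congr 1; module
        _ ≤ t * r + r := by
              refine (norm_add_le _ _).trans ?_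
              rw [norm_neg, norm_smul, norm_smul, norm_eq_of_mem_sphere, mul_one,
                Real.norm_of_nonneg ht0.le]
              refine add_le_add (mul_le_mul_of_nonneg_left hw ht0.le) ?_
              rw [Real.norm_eq_abs, abs_le]
              constructor <;> nlinarith
        _ ≤ 2 * r := by nlinarith
  have hball0 : volume (Metric.ball (0 : EuclideanSpace ℝ (Fin d)) 1) ≠ 0 :=
    (Metric.measure_ball_pos volume _ one_pos).ne'
  have hballt : volume (Metric.ball (0 : EuclideanSpace ℝ (Fin d)) 1) ≠ ⊤ :=
    measure_ball_lt_top.ne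
  have hvol : volume (Ioo (0 : ℝ) 1 • ((↑) '' {w : UnitSphere d |
      ‖(v : EuclideanSpace ℝ (Fin d)) - w‖ ≤ r} : Set (EuclideanSpace ℝ (Fin d)))) ≤
      ENNReal.ofReal ((1 / (2 * r) + 1) * (2 * r) ^ d) *
        volume (Metric.ball (0 : EuclideanSpace ℝ (Fin d)) 1) := by
    refine (measure_mono hcover).trans ((measure_biUnion_finset_le _ _).trans ?_)
    simp only [Measure.addHaar_closedBall volume _ (show 0 ≤ 2 * r by positivity),
      finrank_euclideanSpace_fin, Finset.sum_const, Finset.card_range, nsmul_eq_mul]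
    rw [← mul_assoc, ENNReal.ofReal_mul (by positivity)]
    gcongr
    rw [← ENNReal.ofReal_natCast]
    exact ENNReal.ofReal_le_ofReal (Nat.ceil_lt_add_one (by positivity)).le
  rw [uniformSphere_apply hmeas]
  calc _ ≤ (volume (Metric.ball (0 : EuclideanSpace ℝ (Fin d)) 1))⁻¹ *
        (ENNReal.ofReal ((1 / (2 * r) + 1) * (2 * r) ^ d) *
          volume (Metric.ball (0 : EuclideanSpace ℝ (Fin d)) 1)) := by gcongr
    _ = _ := by
      rw [mul_comm, mul_assoc, ENNReal.mul_inv_cancel hball0 hballt, mul_one]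

theorem uniformSphere_disagreement_le [NeZero d] (v : UnitSphere d) {ε : ℝ} (hε : 0 < ε)
    (hε' : ε ≤ 1 / (4 * Real.pi)) :
    uniformSphere d {w | disagreement v w ≤ ε} ≤
      ENNReal.ofReal ((1 / (8 * ε) + 1) * (8 * ε) ^ d) := by
  have h := uniformSphere_cap_le v (show 0 < 4 * ε by positivity)
  rw [show 2 * (4 * ε) = 8 * ε by ring] at h
  exact (measure_mono fun w hw => norm_sub_le_of_disagreement_le hε hε' hw).trans h

end Geometry

/-! ### Change of oracle: divergence accumulated by a run. -/

theorem toOuterMeasure_le_one {α : Type*} (p : PMF α) (E : Set α) : p.toOuterMeasure E ≤ 1 := by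
  have h : p.toOuterMeasure Set.univ = 1 :=
    (p.toOuterMeasure_apply_eq_one_iff _).mpr (Set.subset_univ _)
  exact h ▸ p.toOuterMeasure.mono (Set.subset_univ E)

namespace ActiveLearner

variable (A : ActiveLearner.{u} d) (O O' : LabelingOracle d) (ω : A.Coin) (s : ℕ → UnitSphere d)

theorem run_of_output {h : List (UnitSphere d × Bool)} {v : UnitSphere d}
    (hv : A.next ω s h = Sum.inr v) (n : ℕ) : A.run O ω s n h = PMF.pure (some v) := by
  cases n <;> simp [run, hv]

theorem run_zero_of_query {h : List (UnitSphere d × Bool)} {x : UnitSphere d}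
    (hx : A.next ω s h = Sum.inl x) : A.run O ω s 0 h = PMF.pure none := by
  simp [run, hx]

theorem toOuterMeasure_run_succ_of_query {h : List (UnitSphere d × Bool)} {x : UnitSphere d}
    (hx : A.next ω s h = Sum.inl x) (n : ℕ) (E : Set (Option (UnitSphere d))) :
    (A.run O ω s (n + 1) h).toOuterMeasure E =
      O.label x true * (A.run O ω s n (h ++ [(x, true)])).toOuterMeasure E +
      O.label x false * (A.run O ω s n (h ++ [(x, false)])).toOuterMeasure E := by
  rw [run, hx]
  simp only [PMF.toOuterMeasure_bind_apply, tsum_fintype, Fintype.sum_bool]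

theorem toOuterMeasure_run_mono {E : Set (Option (UnitSphere d))} (hE : none ∉ E) {m n : ℕ}
    (hmn : m ≤ n) (h : List (UnitSphere d × Bool)) :
    (A.run O ω s m h).toOuterMeasure E ≤ (A.run O ω s n h).toOuterMeasure E := by
  induction m generalizing n h with
  | zero =>
    cases hx : A.next ω s h with
    | inl x => simp [run_zero_of_query A O ω s hx, hE]
    | inr v => rw [run_of_output A O ω s hx, run_of_output A O ω s hx]
  | succ m ih =>
    obtain ⟨n, rfl⟩ : ∃ k, n = k + 1 := ⟨n - 1, by omega⟩
    cases hx : A.next ω s h with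
    | inl x =>
      rw [toOuterMeasure_run_succ_of_query A O ω s hx, toOuterMeasure_run_succ_of_query A O ω s hx]
      exact add_le_add (mul_le_mul' le_rfl (ih (Nat.le_of_succ_le_succ hmn) _))
        (mul_le_mul' le_rfl (ih (Nat.le_of_succ_le_succ hmn) _))
    | inr v => rw [run_of_output A O ω s hx, run_of_output A O ω s hx]

theorem successProb_mono (w : UnitSphere d) (ε : ℝ) {m n : ℕ} (hmn : m ≤ n) :
    A.successProb O w ε m ≤ A.successProb O w ε n :=
  lintegral_mono fun p => A.toOuterMeasure_run_mono O p.1 p.2 (by simp) hmn []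

theorem label_toReal_add (x : UnitSphere d) :
    (O.label x true).toReal + (O.label x false).toReal = 1 := by
  have h := (O.label x).tsum_coe
  rw [tsum_fintype, Fintype.sum_bool] at h
  rw [← ENNReal.toReal_add (PMF.apply_ne_top _ _) (PMF.apply_ne_top _ _), h, ENNReal.toReal_one]

/-- One step of the chain rule for the Donsker-Varadhan functional. -/
theorem variational_step {P Q p q a b K : ℝ} (hP : 0 ≤ P) (hQ : 0 < Q) (hq : 0 ≤ q) (hq1 : q ≤ 1)
    (ih : ∀ a b : ℝ,
      a * p + b * (1 - p) - (q * Real.exp a + (1 - q) * Real.exp b) + 1 ≤ K) :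
    P * (a * p + b * (1 - p) + 1) - Q * (q * Real.exp a + (1 - q) * Real.exp b) ≤
      P * K + P ^ 2 / Q - P := by
  rcases hP.eq_or_lt with rfl | hP
  · have : 0 ≤ Q * (q * Real.exp a + (1 - q) * Real.exp b) := by
      have := sub_nonneg.mpr hq1
      positivity
    simpa using this
  · have hlog := Real.log_le_sub_one_of_pos (div_pos hP hQ)
    -- Shifting both parameters by log(P/Q) absorbs the likelihood ratio of the answer into the
    -- exponentials; the shift costs P log(P/Q) ≤ P²/Q - P.
    have h := mul_le_mul_of_nonneg_left
      (ih (a - Real.log (P / Q)) (b - Real.log (P / Q))) hP.le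
    rw [Real.exp_sub, Real.exp_sub, Real.exp_log (div_pos hP hQ)] at h
    have h1 : P * (q * (Real.exp a / (P / Q)) + (1 - q) * (Real.exp b / (P / Q))) =
        Q * (q * Real.exp a + (1 - q) * Real.exp b) := by
      field_simp
    have h2 : P * Real.log (P / Q) ≤ P ^ 2 / Q - P := by
      calc _ ≤ P * (P / Q - 1) := mul_le_mul_of_nonneg_left hlog hP.le
        _ = _ := by ring
    linarith

/-- Two oracles whose answers have `χ²`-divergence at most `κ` at every point are hard to
distinguish with few queries: a linearized data-processing inequality for the Kullback-Leibler
divergence between the laws of the runs. -/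
theorem run_variational {κ : ℝ} (hκ0 : 0 ≤ κ) (hpos : ∀ x y, O'.label x y ≠ 0)
    (hκ : ∀ x, (O.label x true).toReal ^ 2 / (O'.label x true).toReal +
      (O.label x false).toReal ^ 2 / (O'.label x false).toReal ≤ 1 + κ)
    (E : Set (Option (UnitSphere d))) (n : ℕ) (h : List (UnitSphere d × Bool)) (a b : ℝ) :
    a * ((A.run O ω s n h).toOuterMeasure E).toReal +
      b * (1 - ((A.run O ω s n h).toOuterMeasure E).toReal) -
      (((A.run O' ω s n h).toOuterMeasure E).toReal * Real.exp a +
        (1 - ((A.run O' ω s n h).toOuterMeasure E).toReal) * Real.exp b) + 1 ≤ n * κ := by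
  have hpure (a b : ℝ) (c : Option (UnitSphere d)) (m : ℕ) :
      a * ((PMF.pure c).toOuterMeasure E).toReal +
      b * (1 - ((PMF.pure c).toOuterMeasure E).toReal) -
      (((PMF.pure c).toOuterMeasure E).toReal * Real.exp a +
        (1 - ((PMF.pure c).toOuterMeasure E).toReal) * Real.exp b) + 1 ≤ m * κ := by
    have hm : 0 ≤ m * κ := by positivity
    rw [PMF.toOuterMeasure_pure_apply]
    split_ifs
    · simp only [ENNReal.toReal_one]; linarith [Real.add_one_le_exp a]
    · simp only [ENNReal.toReal_zero]; linarith [Real.add_one_le_exp b]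
  induction n generalizing h a b with
  | zero =>
    cases hx : A.next ω s h with
    | inl x =>
      rw [run_zero_of_query A O ω s hx, run_zero_of_query A O' ω s hx]
      exact hpure _ _ _ _
    | inr v =>
      rw [run_of_output A O ω s hx, run_of_output A O' ω s hx]
      exact hpure _ _ _ _
  | succ n ih =>
    cases hx : A.next ω s h with
    | inl x =>
      have hne (O : LabelingOracle d) (y : Bool) :
          O.label x y * (A.run O ω s n (h ++ [(x, y)])).toOuterMeasure E ≠ ⊤ :=
        ENNReal.mul_ne_top (PMF.apply_ne_top _ _)
          ((toOuterMeasure_le_one _ _).trans_lt ENNReal.one_lt_top).ne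
      have hQ (y : Bool) : 0 < (O'.label x y).toReal :=
        ENNReal.toReal_pos (hpos x y) (PMF.apply_ne_top _ _)
      -- Summed over both answers, the terms P²/Q - P give the χ²-divergence at `x`, at most `κ`,
      -- and the remaining n queries give n`κ`.
      have hstep (y : Bool) := variational_step (P := (O.label x y).toReal) (a := a) (b := b)
        ENNReal.toReal_nonneg (hQ y) ENNReal.toReal_nonneg
        (ENNReal.toReal_mono ENNReal.one_ne_top (toOuterMeasure_le_one _ _))
        (ih (h ++ [(x, y)]))
      have ht := hstep true
      have hf := hstep false
      rw [toOuterMeasure_run_succ_of_query A O ω s hx, toOuterMeasure_run_succ_of_query A O' ω s hx,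
        ENNReal.toReal_add (hne O true) (hne O false),
        ENNReal.toReal_add (hne O' true) (hne O' false)]
      simp only [ENNReal.toReal_mul]
      have h1 := label_toReal_add O x
      have h2 := label_toReal_add O' x
      have h3 := hκ x
      rw [← eq_sub_iff_add_eq'] at h1 h2
      rw [h1, h2] at hf h3
      rw [h1, h2]
      push_cast
      linarith
    | inr v =>
      rw [run_of_output A O ω s hx, run_of_output A O' ω s hx]
      exact hpure _ _ _ _

/-- The law of the coins and of the unlabeled examples. -/
abbrev inputLaw : Measure (A.Coin × (ℕ → UnitSphere d)) :=
  A.coinLaw.prod (Measure.infinitePi fun _ : ℕ => uniformSphere d)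

instance isProbabilityMeasure_inputLaw [NeZero d] : IsProbabilityMeasure A.inputLaw := by
  have := isProbabilityMeasure_uniformSphere d (NeZero.ne d)
  infer_instance

/-- The probability that the run with oracle `O` and at most `n` queries results in `E`. -/
def eventProb (n : ℕ) (E : Set (Option (UnitSphere d))) : ℝ≥0∞ :=
  ∫⁻ p, (A.run O p.1 p.2 n []).toOuterMeasure E ∂A.inputLaw

theorem eventProb_le_one [NeZero d] (n : ℕ) (E : Set (Option (UnitSphere d))) :
    A.eventProb O n E ≤ 1 := by
  refine (lintegral_mono fun p => toOuterMeasure_le_one _ E).trans ?_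
  simp

/-- Superadditivity of the lower integral suffices, so no measurability of the events is required.
-/
theorem eventProb_add_le_one [NeZero d] (n : ℕ) {E F : Set (Option (UnitSphere d))}
    (hEF : Disjoint E F) : A.eventProb O n E + A.eventProb O n F ≤ 1 := by
  refine (le_lintegral_add _ _).trans ((lintegral_mono (g := fun _ => 1) fun p => ?_).trans ?_)
  · refine le_trans (le_of_eq ?_) (toOuterMeasure_le_one (A.run O p.1 p.2 n []) (E ∪ F))
    simp only [PMF.toOuterMeasure_apply, ← ENNReal.tsum_add]
    rw [Set.indicator_union_of_disjoint hEF]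
  · simp

theorem eventProb_variational [NeZero d] {κ : ℝ} (hκ0 : 0 ≤ κ)
    (hpos : ∀ x y, O'.label x y ≠ 0)
    (hκ : ∀ x, (O.label x true).toReal ^ 2 / (O'.label x true).toReal +
      (O.label x false).toReal ^ 2 / (O'.label x false).toReal ≤ 1 + κ)
    (E : Set (Option (UnitSphere d))) (n : ℕ) {a b : ℝ} (hab : b ≤ a) :
    a * (A.eventProb O n E).toReal + b * (1 - (A.eventProb O n E).toReal) -
      ((A.eventProb O' n E).toReal * Real.exp a +
        (1 - (A.eventProb O' n E).toReal) * Real.exp b) + 1 ≤ n * κ := by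
  have hD : 0 ≤ Real.exp a - Real.exp b := sub_nonneg.mpr (Real.exp_le_exp.mpr hab)
  have hC : 0 ≤ n * κ - 1 - b + Real.exp b := by
    have : 0 ≤ n * κ := by positivity
    linarith [Real.add_one_le_exp b]
  have hne (O : LabelingOracle d) : A.eventProb O n E ≠ ⊤ :=
    ((A.eventProb_le_one O n E).trans_lt ENNReal.one_lt_top).ne
  -- Rearranged so that, thanks to b ≤ a, every coefficient is nonnegative and the pointwise
  -- inequality can be integrated in `ℝ≥0∞`.
  have key : ENNReal.ofReal (a - b) * A.eventProb O n E ≤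
      ENNReal.ofReal (n * κ - 1 - b + Real.exp b) +
        ENNReal.ofReal (Real.exp a - Real.exp b) * A.eventProb O' n E := by
    calc ENNReal.ofReal (a - b) * A.eventProb O n E
        = ∫⁻ p, ENNReal.ofReal (a - b) * (A.run O p.1 p.2 n []).toOuterMeasure E
            ∂A.inputLaw := (lintegral_const_mul' _ _ ENNReal.ofReal_ne_top).symm
      _ ≤ ∫⁻ p, (ENNReal.ofReal (n * κ - 1 - b + Real.exp b) +
            ENNReal.ofReal (Real.exp a - Real.exp b) *
              (A.run O' p.1 p.2 n []).toOuterMeasure E) ∂A.inputLaw := by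
          refine lintegral_mono fun p => ?_
          have h := A.run_variational O O' p.1 p.2 hκ0 hpos hκ E n [] a b
          have hne (O : LabelingOracle d) : (A.run O p.1 p.2 n []).toOuterMeasure E ≠ ⊤ :=
            ((toOuterMeasure_le_one _ _).trans_lt ENNReal.one_lt_top).ne
          rw [← ENNReal.ofReal_toReal (hne O), ← ENNReal.ofReal_toReal (hne O'),
            ← ENNReal.ofReal_mul (sub_nonneg.mpr hab), ← ENNReal.ofReal_mul hD,
            ← ENNReal.ofReal_add hC (mul_nonneg hD ENNReal.toReal_nonneg)]
          exact ENNReal.ofReal_le_ofReal (by linarith)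
      _ = _ := by
          rw [lintegral_add_left measurable_const, lintegral_const, measure_univ, mul_one,
            lintegral_const_mul' _ _ ENNReal.ofReal_ne_top]
          rfl
  rw [← ENNReal.ofReal_toReal (hne O), ← ENNReal.ofReal_toReal (hne O'),
    ← ENNReal.ofReal_mul (sub_nonneg.mpr hab), ← ENNReal.ofReal_mul hD,
    ← ENNReal.ofReal_add hC (mul_nonneg hD ENNReal.toReal_nonneg),
    ENNReal.ofReal_le_ofReal_iff (add_nonneg hC (mul_nonneg hD ENNReal.toReal_nonneg))] at key
  linarith

end ActiveLearner

/-! ### Joint measurability of runs, and averaging over the target. -/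

theorem _root_.Measurable.apply_sum {Q α β γ : Type*} [MeasurableSpace Q] [MeasurableSpace α]
    [MeasurableSpace β] [MeasurableSpace γ] {F : Q → α ⊕ β → γ} {N : Q → α ⊕ β}
    (hN : Measurable N) (hl : Measurable fun p : Q × α => F p.1 (Sum.inl p.2))
    (hr : Measurable fun p : Q × β => F p.1 (Sum.inr p.2)) : Measurable fun q => F q (N q) := by
  have h : Measurable fun p : Q × (α ⊕ β) => F p.1 p.2 := by
    have h' : Measurable ((fun p : Q × (α ⊕ β) => F p.1 p.2) ∘
        (MeasurableEquiv.prodSumDistrib Q α β).symm) := measurable_fun_sum hl hr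
    exact ((MeasurableEquiv.prodSumDistrib Q α β).symm.measurable_comp_iff).mp h'
  exact h.comp (measurable_id.prodMk hN)

theorem measurable_snoc {α : Type*} [MeasurableSpace α] (k : ℕ) :
    Measurable fun p : (Fin k → α) × α => (Fin.snoc p.1 p.2 : Fin (k + 1) → α) := by
  refine measurable_pi_iff.mpr fun i => ?_
  refine Fin.lastCases ?_ (fun j => ?_) i
  · simpa using measurable_snd
  · simp only [Fin.snoc_castSucc]
    exact (measurable_pi_apply j).comp measurable_fst

theorem ofFn_snoc {α : Type*} {k : ℕ} (f : Fin k → α) (x : α) :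
    List.ofFn (Fin.snoc f x : Fin (k + 1) → α) = List.ofFn f ++ [x] := by
  rw [List.ofFn_succ_last]
  simp

theorem measurableSet_disagreement_le [NeZero d] {α : Type*} [MeasurableSpace α]
    {f g : α → UnitSphere d} (hf : Measurable f) (hg : Measurable g) (ε : ℝ) :
    MeasurableSet {x | disagreement (f x) (g x) ≤ ε} := by
  have h : Measurable fun x => disagreement (f x) (g x) :=
    (measurable_disagreement (d := d)).comp (g := fun p : UnitSphere d × UnitSphere d =>
      disagreement p.1 p.2) (f := fun x => (f x, g x)) (hf.prodMk hg)
  exact measurableSet_le h measurable_const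

/-- The outcomes in which the learner stops with an `ε`-accurate approximation of `w`. -/
def successSet (w : UnitSphere d) (ε : ℝ) : Set (Option (UnitSphere d)) :=
  {r | ∃ v, r = some v ∧ disagreement v w ≤ ε}

theorem some_mem_successSet {v w : UnitSphere d} {ε : ℝ} :
    some v ∈ successSet w ε ↔ disagreement v w ≤ ε :=
  ⟨fun ⟨_, h, hv⟩ => Option.some_injective _ h ▸ hv, fun h => ⟨v, rfl, h⟩⟩

theorem none_notMem_successSet {w : UnitSphere d} {ε : ℝ} : none ∉ successSet w ε := by
  simp [successSet]

namespace ActiveLearner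

variable (A : ActiveLearner.{u} d) (O : LabelingOracle d)

/-- Joint measurability in target and input is what permits Fubini when the target is averaged. The
history length k varies in the induction because each query lengthens the history. -/
theorem measurable_run [NeZero d] (ε : ℝ) (n k : ℕ) :
    Measurable fun q : UnitSphere d × A.Coin × (ℕ → UnitSphere d) ×
        (Fin k → UnitSphere d × Bool) =>
      (A.run O q.2.1 q.2.2.1 n (List.ofFn q.2.2.2)).toOuterMeasure (successSet q.1 ε) := by
  classical
  have hnext (k : ℕ) : Measurable fun q : UnitSphere d × A.Coin × (ℕ → UnitSphere d) ×
      (Fin k → UnitSphere d × Bool) => A.next q.2.1 q.2.2.1 (List.ofFn q.2.2.2) :=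
    (A.measurable_next k).comp measurable_snd
  have houtput (k : ℕ) : Measurable fun p : (UnitSphere d × A.Coin × (ℕ → UnitSphere d) ×
      (Fin k → UnitSphere d × Bool)) × UnitSphere d =>
      if disagreement p.2 p.1.1 ≤ ε then (1 : ℝ≥0∞) else 0 := by
    exact Measurable.ite (measurableSet_disagreement_le measurable_snd measurable_fst.fst ε)
      measurable_const measurable_const
  induction n generalizing k with
  | zero =>
    have hm := Measurable.apply_sum (F := fun (q : UnitSphere d × A.Coin × (ℕ → UnitSphere d) ×
        (Fin k → UnitSphere d × Bool)) => Sum.elim (fun _ : UnitSphere d => (0 : ℝ≥0∞))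
      fun v => if disagreement v q.1 ≤ ε then (1 : ℝ≥0∞) else 0)
      (hnext k) measurable_const (houtput k)
    convert hm using 2 with q
    cases hx : A.next q.2.1 q.2.2.1 (List.ofFn q.2.2.2) with
    | inl x =>
      rw [run_zero_of_query A O _ _ hx, PMF.toOuterMeasure_pure_apply,
        if_neg none_notMem_successSet, Sum.elim_inl]
    | inr v =>
      rw [run_of_output A O _ _ hx, PMF.toOuterMeasure_pure_apply, Sum.elim_inr]
      simp only [some_mem_successSet]
  | succ n ih =>
    have hquery (y : Bool) : Measurable fun p : (UnitSphere d × A.Coin × (ℕ → UnitSphere d) ×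
        (Fin k → UnitSphere d × Bool)) × UnitSphere d => O.label p.2 y *
        (A.run O p.1.2.1 p.1.2.2.1 n
          (List.ofFn p.1.2.2.2 ++ [(p.2, y)])).toOuterMeasure (successSet p.1.1 ε) := by
      refine ((O.measurable_label y).comp measurable_snd).mul ?_
      simp only [← ofFn_snoc]
      exact (ih (k + 1)).comp (f := fun p : (UnitSphere d × A.Coin × (ℕ → UnitSphere d) ×
        (Fin k → UnitSphere d × Bool)) × UnitSphere d => (p.1.1, p.1.2.1, p.1.2.2.1,
          (Fin.snoc p.1.2.2.2 (p.2, y) : Fin (k + 1) → UnitSphere d × Bool)))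
        (measurable_fst.fst.prodMk (measurable_fst.snd.fst.prodMk
          (measurable_fst.snd.snd.fst.prodMk ((measurable_snoc k).comp
            (measurable_fst.snd.snd.snd.prodMk (measurable_snd.prodMk measurable_const))))))
    have hm := Measurable.apply_sum (F := fun (q : UnitSphere d × A.Coin × (ℕ → UnitSphere d) ×
        (Fin k → UnitSphere d × Bool)) => Sum.elim
      (fun x => O.label x true * (A.run O q.2.1 q.2.2.1 n
          (List.ofFn q.2.2.2 ++ [(x, true)])).toOuterMeasure (successSet q.1 ε) +
        O.label x false * (A.run O q.2.1 q.2.2.1 n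
          (List.ofFn q.2.2.2 ++ [(x, false)])).toOuterMeasure (successSet q.1 ε))
      fun v => if disagreement v q.1 ≤ ε then (1 : ℝ≥0∞) else 0)
      (hnext k) ((hquery true).add (hquery false)) (houtput k)
    convert hm using 2 with q
    cases hx : A.next q.2.1 q.2.2.1 (List.ofFn q.2.2.2) with
    | inl x =>
      rw [toOuterMeasure_run_succ_of_query A O _ _ hx, Sum.elim_inl]
    | inr v =>
      rw [run_of_output A O _ _ hx, PMF.toOuterMeasure_pure_apply, Sum.elim_inr]
      simp only [some_mem_successSet]

theorem measurable_run_nil [NeZero d] (ε : ℝ) (n : ℕ) :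
    Measurable fun q : UnitSphere d × A.Coin × (ℕ → UnitSphere d) =>
      (A.run O q.2.1 q.2.2 n []).toOuterMeasure (successSet q.1 ε) := by
  have h := (A.measurable_run O ε n 0).comp
    (f := fun q : UnitSphere d × A.Coin × (ℕ → UnitSphere d) => (q.1, q.2.1, q.2.2, Fin.elim0))
    (by fun_prop)
  simpa [Function.comp_def] using h

/-- The oracle does not depend on `w`, so each possible output is a fixed vector when `w` is
averaged; a run is a mixture of such outputs and of failures. -/
theorem lintegral_pmf_successSet_le [NeZero d] {ε : ℝ} {c : ℝ≥0∞}
    (hc : ∀ v : UnitSphere d, uniformSphere d {w | disagreement v w ≤ ε} ≤ c)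
    (ω : A.Coin) (s : ℕ → UnitSphere d) (n k : ℕ) (h : Fin k → UnitSphere d × Bool) :
    ∫⁻ w, (A.run O ω s n (List.ofFn h)).toOuterMeasure (successSet w ε) ∂uniformSphere d ≤ c := by
  classical
  have hmeas (n k : ℕ) (h : Fin k → UnitSphere d × Bool) : Measurable fun w =>
      (A.run O ω s n (List.ofFn h)).toOuterMeasure (successSet w ε) :=
    (A.measurable_run O ε n k).comp (f := fun w : UnitSphere d => (w, ω, s, h)) (by fun_prop)
  have houtput (v : UnitSphere d) :
      ∫⁻ w, (PMF.pure (some v)).toOuterMeasure (successSet w ε) ∂uniformSphere d ≤ c := by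
    refine le_trans (le_of_eq ?_) (hc v)
    have hm : MeasurableSet {w | disagreement v w ≤ ε} :=
      measurableSet_disagreement_le measurable_const measurable_id ε
    rw [← lintegral_indicator_one hm]
    congr 1 with w
    simp [PMF.toOuterMeasure_pure_apply, some_mem_successSet, Set.indicator_apply]
  induction n generalizing k h with
  | zero =>
    cases hx : A.next ω s (List.ofFn h) with
    | inl x => simp [run_zero_of_query A O ω s hx, none_notMem_successSet]
    | inr v => simpa only [run_of_output A O ω s hx] using houtput v
  | succ n ih =>
    cases hx : A.next ω s (List.ofFn h) with
    | inl x =>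
      simp only [toOuterMeasure_run_succ_of_query A O ω s hx, ← ofFn_snoc]
      rw [lintegral_add_left ((hmeas _ _ _).const_mul _),
        lintegral_const_mul' _ _ (PMF.apply_ne_top _ _),
        lintegral_const_mul' _ _ (PMF.apply_ne_top _ _)]
      have hsum := (O.label x).tsum_coe
      rw [tsum_fintype, Fintype.sum_bool] at hsum
      calc _ ≤ O.label x true * c + O.label x false * c := by gcongr <;> exact ih _ _
        _ = c := by rw [← add_mul, hsum, one_mul]
    | inr v => simpa only [run_of_output A O ω s hx] using houtput v

/-- Against an oracle chosen independently of the target, some target is rarely found. -/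
theorem exists_eventProb_successSet_le [NeZero d] {ε : ℝ} {c : ℝ≥0∞}
    (hc : ∀ v : UnitSphere d, uniformSphere d {w | disagreement v w ≤ ε} ≤ c) (n : ℕ) :
    ∃ w, A.eventProb O n (successSet w ε) ≤ c := by
  have := isProbabilityMeasure_uniformSphere d (NeZero.ne d)
  have hm : Measurable fun q : UnitSphere d × A.Coin × (ℕ → UnitSphere d) =>
      (A.run O q.2.1 q.2.2 n []).toOuterMeasure (successSet q.1 ε) :=
    A.measurable_run_nil O ε n
  obtain ⟨w, hw⟩ := exists_le_lintegral (μ := uniformSphere d)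
    (f := fun w => A.eventProb O n (successSet w ε)) hm.lintegral_prod_right'.aemeasurable
  refine ⟨w, hw.trans ?_⟩
  simp only [eventProb]
  rw [lintegral_lintegral_swap hm.aemeasurable]
  refine (lintegral_mono (g := fun _ => c) fun p => ?_).trans (by simp)
  have h := A.lintegral_pmf_successSet_le O hc p.1 p.2 n 0 Fin.elim0
  simpa only [List.ofFn_zero] using h

end ActiveLearner

/-! ### Random classification noise and its χ²-divergences. -/

/-- Random classification noise: the correct label for `w` is flipped with probability `η`. -/
def noisyOracle (η : ℝ) (h0 : 0 ≤ η) (h1 : η ≤ 1) (w : UnitSphere d) : LabelingOracle d where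
  label x := PMF.ofFintype
    (fun y => ENNReal.ofReal (if y = halfspace w x then 1 - η else η)) (by
      rw [Fintype.sum_bool, ← ENNReal.ofReal_add (by split_ifs <;> linarith)
        (by split_ifs <;> linarith)]
      cases halfspace w x <;> simp)
  measurable_label y := by
    simp only [PMF.ofFintype_apply]
    exact (Measurable.ite (measurableSet_eq_fun measurable_const (measurable_halfspace_right w))
      measurable_const measurable_const).ennreal_ofReal

section noisyOracle

variable {η : ℝ} (h0 : 0 ≤ η) (h1 : η ≤ 1) (w x : UnitSphere d)

theorem noisyOracle_label (y : Bool) : (noisyOracle η h0 h1 w).label x y =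
    ENNReal.ofReal (if y = halfspace w x then 1 - η else η) :=
  rfl

theorem noisyOracle_label_toReal (y : Bool) : ((noisyOracle η h0 h1 w).label x y).toReal =
    if y = halfspace w x then 1 - η else η := by
  rw [noisyOracle_label, ENNReal.toReal_ofReal]
  split_ifs <;> linarith

theorem boundedNoise_noisyOracle : (noisyOracle η h0 h1 w).BoundedNoise η w := by
  intro x
  rw [PMF.toOuterMeasure_apply_fintype, Fintype.sum_bool]
  cases h : halfspace w x <;> simp [noisyOracle_label, h]

theorem noisyOracle_label_ne_zero (hη : 0 < η) (hη1 : η < 1) (y : Bool) :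
    (noisyOracle η h0 h1 w).label x y ≠ 0 := by
  rw [noisyOracle_label, Ne, ENNReal.ofReal_eq_zero, not_le]
  split_ifs <;> linarith

/-- In fact an equality: 2((1-η)² + η²) = 1 + (1-2η)². -/
theorem chiSq_noisyOracle_coin :
    ((noisyOracle η h0 h1 w).label x true).toReal ^ 2 /
        ((noisyOracle (1 / 2) (by norm_num) (by norm_num) w).label x true).toReal +
      ((noisyOracle η h0 h1 w).label x false).toReal ^ 2 /
        ((noisyOracle (1 / 2) (by norm_num) (by norm_num) w).label x false).toReal ≤
      1 + (1 - 2 * η) ^ 2 := by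
  simp only [noisyOracle_label_toReal]
  cases halfspace w x <;> norm_num <;> linarith

theorem chiSq_noisyOracle_neg (hη : 0 < η) (hη2 : η < 1 / 2) :
    ((noisyOracle η h0 h1 w).label x true).toReal ^ 2 /
        ((noisyOracle η h0 h1 (-w)).label x true).toReal +
      ((noisyOracle η h0 h1 w).label x false).toReal ^ 2 /
        ((noisyOracle η h0 h1 (-w)).label x false).toReal ≤
      1 + 2 * (1 - 2 * η) ^ 2 / η := by
  simp only [noisyOracle_label_toReal]
  have h1η : 0 < 1 - η := by linarith
  -- Needed on the equator w · x = 0, where `w` and `-w` both label +1.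
  have hsame : (1 - η) ^ 2 / (1 - η) + η ^ 2 / η ≤ 1 + 2 * (1 - 2 * η) ^ 2 / η := by
    have : 0 ≤ 2 * (1 - 2 * η) ^ 2 / η := by positivity
    rw [sq, mul_div_cancel_right₀ _ h1η.ne', sq, mul_div_cancel_right₀ _ hη.ne']
    linarith
  have hdiff : (1 - η) ^ 2 / η + η ^ 2 / (1 - η) ≤ 1 + 2 * (1 - 2 * η) ^ 2 / η := by
    have : (1 - η) ^ 2 / η + η ^ 2 / (1 - η) = 1 + (1 - 2 * η) ^ 2 / (η * (1 - η)) := by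
      field_simp; ring
    rw [this]
    gcongr 1 + ?_
    rw [div_le_div_iff₀ (by positivity) hη]
    have : 0 ≤ (1 - 2 * η) ^ 2 * η := by positivity
    nlinarith
  cases halfspace w x <;> cases halfspace (-w) x <;> simp only [if_true, if_false, reduceCtorEq] <;>
    linarith

end noisyOracle

theorem disjoint_successSet_neg [NeZero d] (w : UnitSphere d) {ε : ℝ} (hε : ε < 1 / 2) :
    Disjoint (successSet w ε) (successSet (-w) ε) := by
  rw [Set.disjoint_left]
  rintro _ ⟨v, rfl, hv⟩ h
  have hv' := some_mem_successSet.mp h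
  have h1 := disagreement_triangle w v (-w)
  rw [disagreement_neg, disagreement_comm w v] at h1
  linarith

/-! ### The two lower bounds and their combination. -/

/-- The logarithm of the upper bound for the measure of a ball of radius `ε` in the space of
halfspaces. -/
theorem log_cap_bound {n ε : ℝ} (hn : 5 ≤ n) (hε : 0 < ε) (hε' : ε ≤ 1 / (4 * Real.pi)) :
    n * Real.log (1 / ε) / 50 ≤
      3 / 4 * -(Real.log (1 / (8 * ε) + 1) + n * Real.log (8 * ε)) - Real.log 2 := by
  have hx : 0 < 8 * ε := by positivity
  have hε1 : ε * (4 * Real.pi) ≤ 1 := by rwa [le_div_iff₀ (by positivity)] at hε'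
  -- From 8ε ≤ 2/π and π > 3.14. At ε = 1/(4π) the final inequality fails for n = 4, which is where
  -- n ≥ 5 matters.
  have hx1 : 8 * ε ≤ 100 / 157 := by nlinarith [Real.pi_gt_d2]
  have hl : 0 < Real.log 2 := Real.log_pos one_lt_two
  have hL : 13 / 20 * Real.log 2 ≤ -Real.log (8 * ε) := by
    have h1 : Real.log (8 * ε) ≤ Real.log (100 / 157) := Real.log_le_log hx hx1
    have h2 : 20 * Real.log (100 / 157) ≤ 13 * Real.log (1 / 2) := by
      have := Real.log_le_log (by norm_num)
        (show (100 / 157 : ℝ) ^ 20 ≤ (1 / 2) ^ 13 by norm_num)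
      rw [Real.log_pow, Real.log_pow] at this
      exact_mod_cast this
    rw [one_div, Real.log_inv] at h2
    linarith
  have hS : Real.log (1 / (8 * ε) + 1) ≤ 5 / 7 * Real.log 2 - Real.log (8 * ε) := by
    have h1 : 1 / (8 * ε) + 1 = (1 + 8 * ε) / (8 * ε) := by field_simp
    have h2 : Real.log (1 + 8 * ε) ≤ Real.log (257 / 157) :=
      Real.log_le_log (by positivity) (by linarith)
    have h3 : 7 * Real.log (257 / 157) ≤ 5 * Real.log 2 := by
      have := Real.log_le_log (by norm_num) (show (257 / 157 : ℝ) ^ 7 ≤ 2 ^ 5 by norm_num)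
      rw [Real.log_pow, Real.log_pow] at this
      exact_mod_cast this
    rw [h1, Real.log_div (by positivity) hx.ne']
    linarith
  have hε2 : Real.log (1 / ε) = -Real.log (8 * ε) + 3 * Real.log 2 := by
    rw [one_div, Real.log_inv, Real.log_mul (by norm_num) hε.ne',
      show (8 : ℝ) = 2 ^ 3 by norm_num, Real.log_pow]
    push_cast; ring
  rw [hε2]
  nlinarith [mul_nonneg (sub_nonneg.mpr hn) (sub_nonneg.mpr hL),
    mul_nonneg (sub_nonneg.mpr hn) hl.le]

namespace ActiveLearner

variable (A : ActiveLearner.{u} d)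

theorem successProb_eq_eventProb (O : LabelingOracle d) (w : UnitSphere d) (ε : ℝ) (n : ℕ) :
    A.successProb O w ε n = A.eventProb O n (successSet w ε) :=
  rfl

/-- If every target is learned under random classification noise, then many labels are queried. -/
theorem dimension_bound (hd : 4 < d) {η ε δ : ℝ} (hη : 0 ≤ η) (hη2 : η < 1 / 2) (hε : 0 < ε)
    (hε' : ε ≤ 1 / (4 * Real.pi)) (hδ : δ ≤ 1 / 4) (n : ℕ)
    (h : ∀ w, ENNReal.ofReal (1 - δ) ≤
      A.successProb (noisyOracle η hη (by linarith) w) w ε n) :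
    (d : ℝ) * Real.log (1 / ε) / 50 ≤ n * (1 - 2 * η) ^ 2 := by
  have : NeZero d := ⟨by omega⟩
  have hd5 : (5 : ℝ) ≤ d := by exact_mod_cast hd
  set c : ℝ := (1 / (8 * ε) + 1) * (8 * ε) ^ d with hc
  have hc0 : 0 < c := by positivity
  have hlogc : Real.log c = Real.log (1 / (8 * ε) + 1) + d * Real.log (8 * ε) := by
    rw [hc, Real.log_mul (by positivity) (by positivity), Real.log_pow]
  have hcap := log_cap_bound hd5 hε hε'
  rw [← hlogc] at hcap
  have hl : 0 < Real.log 2 := Real.log_pos one_lt_two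
  have hlogε : 0 ≤ Real.log (1 / ε) := by
    refine Real.log_nonneg ?_
    rw [le_div_iff₀ hε, one_mul]
    refine hε'.trans ?_
    rw [div_le_one (by positivity)]
    linarith [Real.pi_gt_three]
  have hlogc0 : Real.log c ≤ 0 := by
    have : 0 ≤ (d : ℝ) * Real.log (1 / ε) := by positivity
    linarith
  obtain ⟨w₀⟩ : Nonempty (UnitSphere d) := by
    have : Nonempty (Fin d) := ⟨⟨0, by omega⟩⟩
    exact (NormedSpace.sphere_nonempty.mpr zero_le_one).to_subtype
  set Q := noisyOracle (1 / 2) (by norm_num) (by norm_num) w₀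
  obtain ⟨w, hw⟩ := A.exists_eventProb_successSet_le Q
    (fun v => uniformSphere_disagreement_le v hε hε') n
  have hQ : ∀ x, Q.label x = (noisyOracle (1 / 2) (by norm_num) (by norm_num) w).label x := by
    intro x
    ext y
    simp only [Q, noisyOracle_label]
    norm_num
  have hp : 3 / 4 ≤ (A.eventProb (noisyOracle η hη (by linarith) w) n (successSet w ε)).toReal := by
    have h' := h w
    rw [successProb_eq_eventProb, ENNReal.ofReal_le_iff_le_toReal
      ((A.eventProb_le_one _ _ _).trans_lt ENNReal.one_lt_top).ne] at h'
    linarith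
  have hq : (A.eventProb Q n (successSet w ε)).toReal ≤ c :=
    ENNReal.toReal_le_of_le_ofReal hc0.le hw
  -- Here e^a = 1/(2c) and e^b = 1/2. As q ≤ c, the exponential terms total at most 1, leaving -p
  -- log c - log 2 with p ≥ 3/4.
  have hvar := A.eventProb_variational (noisyOracle η hη (by linarith) w) Q
    (sq_nonneg (1 - 2 * η))
    (noisyOracle_label_ne_zero _ _ _ · (by norm_num) (by norm_num))
    (fun x => by rw [hQ]; exact chiSq_noisyOracle_coin hη (by linarith) w x)
    (successSet w ε) n (a := -Real.log 2 - Real.log c) (b := -Real.log 2) (by linarith)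
  rw [Real.exp_sub, Real.exp_neg, Real.exp_log two_pos, Real.exp_log hc0] at hvar
  have hq' : (A.eventProb Q n (successSet w ε)).toReal * (2⁻¹ / c) ≤ 2⁻¹ := by
    calc _ ≤ c * (2⁻¹ / c) := by gcongr
      _ = 2⁻¹ := by field_simp
  have hq0 : 0 ≤ (A.eventProb Q n (successSet w ε)).toReal := ENNReal.toReal_nonneg
  nlinarith [mul_nonneg (sub_nonneg.mpr hp) (neg_nonneg.mpr hlogc0)]

/-- If two opposite targets are learned with confidence `1 - δ` under random classification noise,
then many labels are queried. -/
theorem confidence_bound [NeZero d] {η ε δ : ℝ} (hη : 0 < η) (hη2 : η < 1 / 2)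
    (hε : ε < 1 / 2) (hδ0 : 0 < δ) (hδ : δ ≤ 1 / 4) (n : ℕ) (w : UnitSphere d)
    (h : ∀ w, ENNReal.ofReal (1 - δ) ≤
      A.successProb (noisyOracle η hη.le (by linarith) w) w ε n) :
    η * Real.log (1 / δ) / 8 ≤ n * (1 - 2 * η) ^ 2 := by
  set O := noisyOracle η hη.le (by linarith) w
  set O' := noisyOracle η hη.le (by linarith) (-w)
  have hne (O : LabelingOracle d) (E) : A.eventProb O n E ≠ ⊤ :=
    ((A.eventProb_le_one _ _ _).trans_lt ENNReal.one_lt_top).ne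
  have hp : 1 - δ ≤ (A.eventProb O n (successSet w ε)).toReal :=
    (ENNReal.ofReal_le_iff_le_toReal (hne _ _)).mp (h w)
  have hp' : 1 - δ ≤ (A.eventProb O' n (successSet (-w) ε)).toReal :=
    (ENNReal.ofReal_le_iff_le_toReal (hne _ _)).mp (h (-w))
  have hq : (A.eventProb O' n (successSet w ε)).toReal ≤ δ := by
    have h1 := A.eventProb_add_le_one O' n (disjoint_successSet_neg w hε)
    have h2 := ENNReal.toReal_mono ENNReal.one_ne_top h1
    rw [ENNReal.toReal_add (hne _ _) (hne _ _), ENNReal.toReal_one] at h2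
    linarith
  have hδ1 : 0 < 1 - δ := by linarith
  have hr : 0 < (1 - δ) / δ := by positivity
  have hr1 : 1 ≤ (1 - δ) / δ := by rw [le_div_iff₀ hδ0]; linarith
  have hlog0 : 0 ≤ Real.log ((1 - δ) / δ) := Real.log_nonneg hr1
  -- The parameters are the log-likelihood ratios between Bernoulli(1-δ) and Bernoulli(δ), optimal
  -- in the extreme case p = 1-δ, q = δ; there the exponential terms total exactly 1.
  have hvar := A.eventProb_variational O O' (κ := 2 * (1 - 2 * η) ^ 2 / η) (by positivity)
    (noisyOracle_label_ne_zero _ _ _ · hη (by linarith))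
    (fun x => chiSq_noisyOracle_neg hη.le (by linarith) w x hη hη2)
    (successSet w ε) n (a := Real.log ((1 - δ) / δ)) (b := -Real.log ((1 - δ) / δ)) (by linarith)
  rw [Real.exp_neg, Real.exp_log hr, inv_div] at hvar
  have hq' : (A.eventProb O' n (successSet w ε)).toReal * ((1 - δ) / δ) +
      (1 - (A.eventProb O' n (successSet w ε)).toReal) * (δ / (1 - δ)) ≤ 1 := by
    have hle : δ / (1 - δ) ≤ (1 - δ) / δ := by
      rw [div_le_div_iff₀ hδ1 hδ0]; nlinarith
    calc _ = (A.eventProb O' n (successSet w ε)).toReal * ((1 - δ) / δ - δ / (1 - δ)) +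
          δ / (1 - δ) := by ring
      _ ≤ δ * ((1 - δ) / δ - δ / (1 - δ)) + δ / (1 - δ) := by
          have := sub_nonneg.mpr hle
          gcongr
      _ = 1 := by field_simp; ring
  have hhalf : Real.log (1 / δ) ≤ 2 * Real.log ((1 - δ) / δ) := by
    have := Real.log_le_log (by positivity) (show 1 / δ ≤ ((1 - δ) / δ) ^ 2 by
      rw [div_pow, div_le_div_iff₀ hδ0 (by positivity)]
      nlinarith)
    rw [Real.log_pow] at this
    exact_mod_cast this
  have hmain : Real.log (1 / δ) / 4 ≤ n * (2 * (1 - 2 * η) ^ 2 / η) := by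
    nlinarith [mul_nonneg (sub_nonneg.mpr hp) hlog0, mul_nonneg (sub_nonneg.mpr hδ) hlog0]
  calc η * Real.log (1 / δ) / 8 = η / 2 * (Real.log (1 / δ) / 4) := by ring
    _ ≤ η / 2 * (n * (2 * (1 - 2 * η) ^ 2 / η)) := by gcongr
    _ = n * (1 - 2 * η) ^ 2 := by field_simp

end ActiveLearner

end HalfspaceLearning

end

theorem mainTheorem3 :
    ∃ c : ℝ, 0 < c ∧
      ∀ (d : ℕ) (η ε δ : ℝ), 4 < d → 0 ≤ η → η < 1 / 2 →
        0 < ε → ε ≤ 1 / (4 * Real.pi) → 0 < δ → δ ≤ 1 / 4 →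
        ∀ A : HalfspaceLearning.ActiveLearner.{u} d,
          ∃ (w : HalfspaceLearning.UnitSphere d) (O : HalfspaceLearning.LabelingOracle d),
            O.BoundedNoise η w ∧
              ∀ n : ℕ, ENNReal.ofReal (1 - δ) ≤ A.successProb O w ε n →
                c * ((d : ℝ) * Real.log (1 / ε) / (1 - 2 * η) ^ 2
                  + η * Real.log (1 / δ) / (1 - 2 * η) ^ 2) ≤ (n : ℝ) := by

  refine ⟨1 / 100, by norm_num, fun d η ε δ hd hη hη2 hε hε' hδ hδ' A => ?_⟩
  by_contra! hcon
  have : NeZero d := ⟨by omega⟩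
  set T := 1 / 100 * ((d : ℝ) * Real.log (1 / ε) / (1 - 2 * η) ^ 2
    + η * Real.log (1 / δ) / (1 - 2 * η) ^ 2) with hT
  have hsucc : ∀ w, ENNReal.ofReal (1 - δ) ≤ A.successProb
      (HalfspaceLearning.noisyOracle η hη (by linarith) w) w ε (⌈T⌉₊ - 1) := by
    intro w
    obtain ⟨n, hn, hnT⟩ := hcon w _
      (HalfspaceLearning.boundedNoise_noisyOracle hη (by linarith) w)
    have := Nat.lt_ceil.mpr hnT
    exact hn.trans (A.successProb_mono _ w ε (by omega))
  obtain ⟨w⟩ : Nonempty (HalfspaceLearning.UnitSphere d) := by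
    have : Nonempty (Fin d) := ⟨⟨0, by omega⟩⟩
    exact (NormedSpace.sphere_nonempty.mpr zero_le_one).to_subtype
  obtain ⟨m, -, hm⟩ := hcon w _ (HalfspaceLearning.boundedNoise_noisyOracle hη (by linarith) w)
  have hT0 : 0 < T := (Nat.cast_nonneg m).trans_lt hm
  -- T > 0 keeps the truncated subtraction honest: ⌈T⌉ - 1 is the largest budget below T.
  have hlt : ((⌈T⌉₊ - 1 : ℕ) : ℝ) < T := Nat.lt_ceil.mp (by
    have := Nat.ceil_pos.mpr hT0
    omega)
  have hη' : 0 < (1 - 2 * η) ^ 2 := by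
    have : 0 < 1 - 2 * η := by linarith
    positivity
  have hdim := A.dimension_bound hd hη hη2 hε hε' hδ' _ hsucc
  have hconf : η * Real.log (1 / δ) / 8 ≤ (⌈T⌉₊ - 1 : ℕ) * (1 - 2 * η) ^ 2 := by
    rcases hη.eq_or_lt with h | h
    · rw [← h]; simp
    · refine A.confidence_bound h hη2 (hε'.trans_lt ?_) hδ hδ' _ w hsucc
      rw [div_lt_div_iff₀ (by positivity) two_pos]
      linarith [Real.pi_gt_three]
  have hTη : T * (1 - 2 * η) ^ 2 =
      1 / 100 * ((d : ℝ) * Real.log (1 / ε) + η * Real.log (1 / δ)) := by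
    rw [hT, ← add_div, mul_div_assoc', div_mul_cancel₀ _ hη'.ne']
  have hlogδ : 0 ≤ η * Real.log (1 / δ) :=
    mul_nonneg hη (Real.log_nonneg (by rw [le_div_iff₀ hδ]; linarith))
  -- The mean of the two bounds has coefficients 1/100 and 1/16, both at least the 1/100 appearing
  -- in T.
  have := mul_lt_mul_of_pos_right hlt hη'
  linarith
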